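/- Let $G$ be a finite simple graph. In the localization game with parameter $k$, an invisible robber first chooses any vertex. In each round the cop chooses a set $W$ of $k$ vertices, which may depend on the answers received in earlier rounds, and learns the graph distance from the robber's current position to each $w\in W$ (distance $\infty$ between different components). The cop wins as soon as all the answers received so far determine the robber's current position; otherwise the robber moves to a neighbouring vertex (staying put if there is none) and the next round begins. The localization number $\zeta(G)$ is the least $k$ for which the cop has a strategy that wins against every behaviour of the robber. For almost all graphs $G$ on $n$ vertices, $$\zeta(G)\approx \frac{2\log n}{\log 2}=2\log_2 n .$$ That is, for every $\varepsilon>0$, the proportion of those among the $2^{\binom n2}$ labelled graphs $G$ on $n$ vertices (equivalently, the probability in $G_{n,1/2}$) that satisfy $$(1-\varepsilon)\,\frac{2\log n}{\log 2}\le \zeta(G)\le (1+\varepsilon)\,\frac{2\log n}{\log 2}$$ tends to $1$ as $n\to\infty$. The same holds for the version of the game in which the robber may also stay at his current vertex in any round. -/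

import Mathlib

open Filter Topology

/-- One move of the robber from `v` to `w` in the localization game on `G`: he moves along an edge.
If `mayStay` is `true` he may also stay where he is; if it is `false` he stays only when `v` has no
neighbour at all. -/
def RobberStep {V : Type*} (G : SimpleGraph V) (mayStay : Bool) (v w : V) : Prop :=
  G.Adj v w ∨ (w = v ∧ (mayStay = true ∨ ∀ u, ¬ G.Adj v u))

/-- The possible behaviours of the robber: `x t` is his position in round `t`, for `t = 0, 1, 2, …`;
the initial position is arbitrary. -/
def IsRobberPath {V : Type*} (G : SimpleGraph V) (mayStay : Bool) (x : ℕ → V) : Prop :=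
  ∀ t, RobberStep G mayStay (x t) (x (t + 1))

/-- The `W`-signature of `v`: for every probed vertex `w ∈ W` the graph distance between `v` and `w`
(`⊤` if they lie in different components), and `none` at the vertices that are not probed. -/
noncomputable def signature {V : Type*} [DecidableEq V] (G : SimpleGraph V) (W : Finset V) (v : V) :
    V → Option ℕ∞ :=
  fun w => if w ∈ W then some (G.edist v w) else none

/-- A strategy of the cop: the next test set, as a function of the list of the signatures that were
received in the earlier rounds. -/
abbrev CopStrategy (V : Type*) : Type _ := List (V → Option ℕ∞) → Finset V

/-- The signatures that a cop with strategy `σ` receives in the rounds `0, …, t - 1` when the robber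
moves along `x`. -/
noncomputable def history {V : Type*} [DecidableEq V] (G : SimpleGraph V) (σ : CopStrategy V)
    (x : ℕ → V) : ℕ → List (V → Option ℕ∞)
  | 0 => []
  | t + 1 => history G σ x t ++ [signature G (σ (history G σ x t)) (x t)]

/-- In round `t` the cop locates a robber who moves along `x`: the signatures of the rounds `0, …, t`
determine the position of the robber in round `t`. -/
def Locates {V : Type*} [DecidableEq V] (G : SimpleGraph V) (mayStay : Bool) (σ : CopStrategy V)
    (x : ℕ → V) (t : ℕ) : Prop :=
  ∀ y : ℕ → V, IsRobberPath G mayStay y →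
    history G σ y (t + 1) = history G σ x (t + 1) → y t = x t

/-- With test sets of size `k` the cop can eventually locate the robber, however he moves. -/
def CopWins {V : Type*} [DecidableEq V] (G : SimpleGraph V) (mayStay : Bool) (k : ℕ) : Prop :=
  ∃ σ : CopStrategy V, (∀ h, (σ h).card = k) ∧
    ∀ x : ℕ → V, IsRobberPath G mayStay x → ∃ t, Locates G mayStay σ x t

/-- The localization number `ζ(G)`: the least `k` such that the cop wins with test sets of size `k`.
(On a finite graph there is such a `k`, as probing every vertex locates the robber.) -/
noncomputable def localizationNumber {V : Type*} [DecidableEq V] (G : SimpleGraph V)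
    (mayStay : Bool) : ℕ :=
  sInf {k : ℕ | CopWins G mayStay k}

/-- Almost all graphs have the property `P`: the proportion of the labelled graphs on `n` vertices
that have it, i.e. the probability of `P` in `G(n, 1/2)`, tends to `1` as `n → ∞`. -/
def AlmostAllGraphs (P : ∀ n : ℕ, SimpleGraph (Fin n) → Prop) : Prop :=
  Tendsto (fun n : ℕ =>
    (Nat.card {G : SimpleGraph (Fin n) // P n G} : ℝ) / (Nat.card (SimpleGraph (Fin n)) : ℝ))
    atTop (𝓝 1)

/-!
A fixed test set `W` with `k` elements fails to resolve a given pair of vertices outside `W` with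
probability at most `2 ^ (-k)`, since already the adjacencies to `W` are independent fair coins. For
`k` slightly above `2 log₂ n` the union bound over the pairs shows that almost surely `W` resolves
the graph, and the cop wins in round `0` (`localizationNumber_le_card_of_adj`,
`graphFreq_forall_adj_iff_le`).

For `k` slightly below `2 log₂ n` the robber escapes a given cop strategy if any two vertices have a
common neighbour and, for every vertex `u` and every test set `W`, some two neighbours of `u` have
the same signature (`not_copWins_of_forall_exists`, `lt_localizationNumber`): in each round he moves
to one of two such neighbours of his current position, and the other one remains possible. When
distinct vertices have common neighbours, distances outside `W` reduce to adjacencies, so two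
neighbours with the same adjacencies to `W` are needed. A vertex `u` has linearly many neighbours
and there are only `2 ^ k ≤ n ^ (2 - 2ε)` adjacency patterns, so by the birthday bound such a pair is
missing with probability `exp (-Ω(n ^ 2ε))` (`graphFreq_injOn_le`), which survives the union bound
over the `exp (O(log² n))` pairs `(u, W)` (`almostAllGraphs_exists_same_neighbors`).

All probabilities are proportions of labelled graphs. Independence and conditioning enter through
`graphFreq_le_of_flip` alone: flipping a family of edge sets permutes the graphs, so it suffices to
bound, for each fixed graph, the proportion of the flips that lead to a bad graph.
-/

/-! ### The game -/

section Game

variable {V : Type*} {G : SimpleGraph V} {mayStay : Bool}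

theorem exists_robberStep (G : SimpleGraph V) (mayStay : Bool) (v : V) :
    ∃ w, RobberStep G mayStay v w := by
  by_cases h : ∃ w, G.Adj v w
  · obtain ⟨w, hw⟩ := h
    exact ⟨w, Or.inl hw⟩
  · exact ⟨v, Or.inr ⟨rfl, Or.inr (not_exists.mp h)⟩⟩

theorem exists_isRobberPath_zero (G : SimpleGraph V) (mayStay : Bool) (v : V) :
    ∃ x, IsRobberPath G mayStay x ∧ x 0 = v := by
  choose f hf using exists_robberStep G mayStay
  refine ⟨fun t => f^[t] v, fun t => ?_, rfl⟩
  simp only [Function.iterate_succ_apply']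
  exact hf _

/-- A robber path may be left at round `t` for any vertex `b` that the robber can reach then. -/
theorem IsRobberPath.exists_deviation {x : ℕ → V} (hx : IsRobberPath G mayStay x) (t : ℕ) (b : V)
    (hb : ∀ s, s + 1 = t → RobberStep G mayStay (x s) b) :
    ∃ y, IsRobberPath G mayStay y ∧ (∀ s < t, y s = x s) ∧ y t = b := by
  obtain ⟨z, hz, hz0⟩ := exists_isRobberPath_zero G mayStay b
  refine ⟨fun s => if s < t then x s else z (s - t), fun s => ?_, fun s hs => by simp [hs],
    by simp [hz0]⟩
  rcases lt_trichotomy (s + 1) t with h | h | h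
  · simpa [h, (Nat.lt_succ_self s).trans h] using hx s
  · have h1 : s < t := by omega
    have h2 : s + 1 - t = 0 := by omega
    simpa [h1, h, h2, hz0] using hb s h
  · have h1 : ¬ s < t := by omega
    have h2 : ¬ s + 1 < t := by omega
    have h3 : s + 1 - t = s - t + 1 := by omega
    simpa [h1, h2, h3] using hz (s - t)

/-- When any two distinct vertices have a common neighbour, the distance to `w ≠ a` only depends on
whether `a` and `w` are adjacent. -/
theorem edist_eq_edist_of_adj_iff (hG : ∀ u v, u ≠ v → ∃ w, G.Adj u w ∧ G.Adj v w) {a b w : V}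
    (ha : a ≠ w) (hb : b ≠ w) (h : G.Adj a w ↔ G.Adj b w) : G.edist a w = G.edist b w := by
  have key : ∀ c, c ≠ w → ¬ G.Adj c w → G.edist c w = 2 := by
    intro c hc hcw
    obtain ⟨z, hz, hz'⟩ := hG c w hc
    refine le_antisymm ?_ ?_
    · have h1 : G.edist c z = 1 := SimpleGraph.edist_eq_one_iff_adj.mpr hz
      have h2 : G.edist z w = 1 := SimpleGraph.edist_eq_one_iff_adj.mpr hz'.symm
      have h3 := G.edist_triangle (u := c) (v := z) (w := w)
      rw [h1, h2] at h3
      exact h3.trans (le_of_eq (by norm_num))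
    · have h1 : 1 < G.edist c w := by
        refine lt_of_le_of_ne ?_ fun h => hcw (SimpleGraph.edist_eq_one_iff_adj.mp h.symm)
        exact Order.one_le_iff_pos.mpr (SimpleGraph.edist_pos_of_ne hc)
      have := Order.add_one_le_of_lt h1
      rwa [one_add_one_eq_two] at this
  by_cases haw : G.Adj a w
  · rw [SimpleGraph.edist_eq_one_iff_adj.mpr haw, SimpleGraph.edist_eq_one_iff_adj.mpr (h.mp haw)]
  · rw [key a ha haw, key b hb fun h' => haw (h.mpr h')]

variable [DecidableEq V]

theorem history_congr (σ : CopStrategy V) {x y : ℕ → V} {t : ℕ} (h : ∀ s < t, y s = x s) :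
    history G σ y t = history G σ x t := by
  induction t with
  | zero => rfl
  | succ t ih =>
    simp only [history]
    rw [ih fun s hs => h s (hs.trans (Nat.lt_succ_self t)), h t (Nat.lt_succ_self t)]

/-- A test set that resolves the graph locates the robber in round `0`. -/
theorem copWins_of_signature_injective (mayStay : Bool) (W : Finset V)
    (hW : Function.Injective (signature G W)) : CopWins G mayStay W.card :=
  ⟨fun _ => W, fun _ => rfl, fun x _ => ⟨0, fun y _ hyx => hW (by simpa [history] using hyx)⟩⟩

theorem signature_eq_iff {W : Finset V} {a b : V} :
    signature G W a = signature G W b ↔ ∀ w ∈ W, G.edist a w = G.edist b w := by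
  constructor
  · intro h w hw
    simpa [signature, hw] using congrFun h w
  · intro h
    funext w
    by_cases hw : w ∈ W
    · simp [signature, hw, h w hw]
    · simp [signature, hw]

theorem signature_univ_injective [Fintype V] :
    Function.Injective (signature G (Finset.univ : Finset V)) := by
  intro a b h
  have := signature_eq_iff.mp h b (Finset.mem_univ b)
  simpa using this

theorem copWins_localizationNumber [Fintype V] (G : SimpleGraph V) (mayStay : Bool) :
    CopWins G mayStay (localizationNumber G mayStay) :=
  Nat.sInf_mem (s := {k | CopWins G mayStay k})
    ⟨_, copWins_of_signature_injective mayStay Finset.univ signature_univ_injective⟩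

/-- If every neighbourhood contains two vertices that the next test set cannot tell apart, the
robber escapes: he moves to one of the two, and the cop cannot rule out the other. -/
theorem not_copWins_of_forall_exists [Nonempty V] {k : ℕ}
    (h : ∀ (u : V) (W : Finset V), W.card = k → ∃ a b, G.Adj u a ∧ G.Adj u b ∧ a ≠ b ∧
      signature G W a = signature G W b) : ¬ CopWins G mayStay k := by
  rintro ⟨σ, hσ, hwin⟩
  choose! A B hA hB hAB hsig using h
  let u₀ : V := Classical.arbitrary V
  -- the history so far, together with a vertex whose neighbours are the robber's options
  let st : ℕ → List (V → Option ℕ∞) × V := fun t =>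
    (fun p => (p.1 ++ [signature G (σ p.1) (A p.2 (σ p.1))], A p.2 (σ p.1)))^[t] ([], u₀)
  have hst : ∀ t, st (t + 1) = ((st t).1 ++ [signature G (σ (st t).1) (A (st t).2 (σ (st t).1))],
      A (st t).2 (σ (st t).1)) := fun t => Function.iterate_succ_apply' _ _ _
  let x : ℕ → V := fun t => A (st t).2 (σ (st t).1)
  have hxs : ∀ t, (st (t + 1)).2 = x t := fun t => by rw [hst]
  have hist : ∀ t, history G σ x t = (st t).1 := by
    intro t
    induction t with
    | zero => rfl
    | succ t ih => rw [hst, history, ih]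
  have hx : IsRobberPath G mayStay x := fun t => by
    refine Or.inl ?_
    have := hA (st (t + 1)).2 (σ (st (t + 1)).1) (hσ _)
    rw [hxs] at this
    simpa [x, hxs] using this
  obtain ⟨t, ht⟩ := hwin x hx
  obtain ⟨y, hy, hyx, hyt⟩ := hx.exists_deviation t (B (st t).2 (σ (st t).1)) (by
    rintro s rfl
    refine Or.inl ?_
    have := hB (st (s + 1)).2 (σ (st (s + 1)).1) (hσ _)
    rw [hxs] at this
    simpa [hxs] using this)
  have hhist := history_congr (G := G) σ hyx
  have heq : y t = x t := by
    refine ht y hy ?_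
    simp only [history]
    rw [hhist, hist, hyt, ← hsig _ _ (hσ _)]
  rw [hyt] at heq
  exact hAB _ _ (hσ _) heq.symm

/-- A vertex of the test set is located by its distance `0` to itself, so it is enough that the
test set separates the vertices outside it by adjacency. -/
theorem signature_injective_of_adj {W : Finset V}
    (h : ∀ a b, a ≠ b → a ∉ W → b ∉ W → ∃ w ∈ W, ¬ (G.Adj a w ↔ G.Adj b w)) :
    Function.Injective (signature G W) := by
  intro a b hab
  rw [signature_eq_iff] at hab
  by_contra hne
  by_cases ha : a ∈ W
  · exact hne (Eq.symm (by simpa using (hab a ha).symm))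
  by_cases hb : b ∈ W
  · exact hne (by simpa using hab b hb)
  obtain ⟨w, hw, hadj⟩ := h a b hne ha hb
  refine hadj ?_
  rw [← SimpleGraph.edist_eq_one_iff_adj, ← SimpleGraph.edist_eq_one_iff_adj, hab w hw]

theorem localizationNumber_le_card_of_adj (mayStay : Bool) {W : Finset V}
    (h : ∀ a b, a ≠ b → a ∉ W → b ∉ W → ∃ w ∈ W, ¬ (G.Adj a w ↔ G.Adj b w)) :
    localizationNumber G mayStay ≤ W.card :=
  Nat.sInf_le (copWins_of_signature_injective mayStay W (signature_injective_of_adj h))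

/-- Suppose that any two distinct vertices have a common neighbour and that, for every vertex `u` and
every `k`-set `W` not containing `u`, some two neighbours of `u` outside `W` have the same neighbours
in `W`. Then the cop needs more than `k` probes. A test set that is smaller or contains `u` reduces to
such a `W`, since all neighbours of `u` have the same distance to `u`. -/
theorem lt_localizationNumber [Fintype V] [Nonempty V] {k : ℕ} (hk : k < Fintype.card V)
    (hG : ∀ u v, u ≠ v → ∃ w, G.Adj u w ∧ G.Adj v w)
    (h : ∀ (u : V) (W : Finset V), W.card = k → u ∉ W → ∃ a b, G.Adj u a ∧ G.Adj u b ∧ a ≠ b ∧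
      a ∉ W ∧ b ∉ W ∧ ∀ w ∈ W, (G.Adj a w ↔ G.Adj b w)) :
    k < localizationNumber G mayStay := by
  by_contra! hle
  refine not_copWins_of_forall_exists (fun u W hW => ?_) (copWins_localizationNumber G mayStay)
  have hsub : W.erase u ⊆ Finset.univ.erase u := Finset.erase_subset_erase _ (Finset.subset_univ _)
  obtain ⟨W', hWW', hW', hcard⟩ := Finset.exists_subsuperset_card_eq hsub
    ((Finset.card_erase_le.trans hW.le).trans hle)
    (by rw [Finset.card_erase_of_mem (Finset.mem_univ u), Finset.card_univ]; omega)
  obtain ⟨a, b, hua, hub, hab, haW, hbW, hadj⟩ := h u W' hcard fun hu => by simpa using hW' hu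
  refine ⟨a, b, hua, hub, hab, signature_eq_iff.mpr fun w hw => ?_⟩
  by_cases hwu : w = u
  · subst hwu
    rw [SimpleGraph.edist_eq_one_iff_adj.mpr hua.symm, SimpleGraph.edist_eq_one_iff_adj.mpr hub.symm]
  · have hw' : w ∈ W' := hWW' (Finset.mem_erase.mpr ⟨hwu, hw⟩)
    exact edist_eq_edist_of_adj_iff hG (fun e => haW (e ▸ hw')) (fun e => hbW (e ▸ hw'))
      (hadj w hw')

end Game

/-! ### Counting labelled graphs -/

/-- The proportion of the labelled graphs on `V` that have the property `P`. -/
noncomputable def graphFreq {V : Type*} (P : SimpleGraph V → Prop) : ℝ :=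
  (Nat.card {G : SimpleGraph V // P G} : ℝ) / (Nat.card (SimpleGraph V) : ℝ)

theorem graphFreq_nonneg {V : Type*} (P : SimpleGraph V → Prop) : 0 ≤ graphFreq P := by
  unfold graphFreq; positivity

section Freq

variable {V : Type*} [Finite V]

theorem graphFreq_mono {P Q : SimpleGraph V → Prop} (h : ∀ G, P G → Q G) :
    graphFreq P ≤ graphFreq Q := by
  unfold graphFreq
  gcongr
  exact Nat.card_le_card_of_injective (fun G : {G // P G} => (⟨G.1, h _ G.2⟩ : {G // Q G}))
    fun a b hab => Subtype.ext (congrArg (fun G : {G // Q G} => G.1) hab)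

theorem graphFreq_not (P : SimpleGraph V → Prop) :
    graphFreq P = 1 - graphFreq fun G => ¬ P G := by
  classical
  have := Fintype.ofFinite V
  have hpos : (0 : ℝ) < Nat.card (SimpleGraph V) := by
    exact_mod_cast Nat.card_pos
  have h : Nat.card {G : SimpleGraph V // P G} + Nat.card {G : SimpleGraph V // ¬ P G}
      = Nat.card (SimpleGraph V) := by
    rw [← Nat.card_sum, Nat.card_congr (Equiv.sumCompl P)]
  unfold graphFreq
  rw [eq_sub_iff_add_eq, ← add_div, div_eq_one_iff_eq hpos.ne']
  exact_mod_cast h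

theorem graphFreq_or_le (P Q : SimpleGraph V → Prop) :
    graphFreq (fun G => P G ∨ Q G) ≤ graphFreq P + graphFreq Q := by
  classical
  have := Fintype.ofFinite V
  unfold graphFreq
  rw [← add_div]
  gcongr
  have := Fintype.card_subtype_or P Q
  simp only [Nat.card_eq_fintype_card]
  exact_mod_cast this

/-- The union bound. -/
theorem graphFreq_exists_mem_le {ι : Type*} (I : Finset ι) (P : ι → SimpleGraph V → Prop) (c : ℝ)
    (h : ∀ i ∈ I, graphFreq (P i) ≤ c) :
    graphFreq (fun G => ∃ i ∈ I, P i G) ≤ I.card * c := by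
  classical
  induction I using Finset.induction_on with
  | empty => simp [graphFreq]
  | insert i s hi ih =>
    have h1 : graphFreq (fun G => ∃ j ∈ insert i s, P j G) ≤
        graphFreq (fun G => P i G ∨ ∃ j ∈ s, P j G) :=
      graphFreq_mono fun G hG => by simpa using hG
    have h2 := graphFreq_or_le (P i) (fun G => ∃ j ∈ s, P j G)
    have h3 := h i (Finset.mem_insert_self _ _)
    have h4 := ih fun j hj => h j (Finset.mem_insert_of_mem hj)
    rw [Finset.card_insert_of_notMem hi]
    push_cast
    linarith

/-- Averaging over edge flips: each symmetric difference `G ↦ G ∆ H b` permutes the graphs on `V`,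
so a property that holds for at most a proportion `c` of the graphs `G ∆ H b`, for every fixed `G`,
has frequency at most `c`. This does the work of conditioning on the edges that are not flipped. -/
theorem graphFreq_le_of_flip {β : Type*} [Fintype β] [Nonempty β] (H : β → SimpleGraph V)
    (P : SimpleGraph V → Prop) [∀ G b, Decidable (P (symmDiff G (H b)))] (c : ℝ)
    (h : ∀ G : SimpleGraph V,
      ((Finset.univ.filter fun b => P (symmDiff G (H b))).card : ℝ) ≤ c * Fintype.card β) :
    graphFreq P ≤ c := by
  classical
  have := Fintype.ofFinite V
  have hpos : (0 : ℝ) < Nat.card (SimpleGraph V) := by exact_mod_cast Nat.card_pos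
  have hβ : (0 : ℝ) < Fintype.card β := by exact_mod_cast Fintype.card_pos
  unfold graphFreq
  rw [div_le_iff₀ hpos]
  simp only [Nat.card_eq_fintype_card]
  rw [Fintype.card_subtype]
  have key : (Fintype.card β : ℝ) * ((Finset.univ.filter P).card : ℝ)
      = ∑ G : SimpleGraph V,
        ((Finset.univ.filter fun b => P (symmDiff G (H b))).card : ℝ) := by
    simp only [Finset.card_filter, Nat.cast_sum]
    rw [Finset.sum_comm]
    have : ∀ b : β, ∑ G : SimpleGraph V, (((if P (symmDiff G (H b)) then 1 else 0 : ℕ)) : ℝ)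
        = ∑ G : SimpleGraph V, ((if P G then 1 else 0 : ℕ) : ℝ) := fun b => by
      convert Equiv.sum_comp (Function.Involutive.toPerm (fun G => symmDiff G (H b))
        fun G => symmDiff_symmDiff_cancel_right _ _) (fun G => ((if P G then 1 else 0 : ℕ) : ℝ))
      rfl
    simp only [this, Finset.sum_const, Finset.card_univ, nsmul_eq_mul]
  have h5 := Finset.sum_le_sum fun (G : SimpleGraph V) (_ : G ∈ Finset.univ) => h G
  rw [← key, Finset.sum_const, nsmul_eq_mul, Finset.card_univ] at h5
  exact le_of_mul_le_mul_left (by linarith) hβ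

end Freq

section AlmostAll

theorem almostAllGraphs_of_graphFreq_le {P : ∀ n : ℕ, SimpleGraph (Fin n) → Prop} {δ : ℕ → ℝ}
    (hδ : Tendsto δ atTop (𝓝 0)) (h : ∀ᶠ n in atTop, graphFreq (fun G => ¬ P n G) ≤ δ n) :
    AlmostAllGraphs P := by
  have h0 : Tendsto (fun n => graphFreq fun G => ¬ P n G) atTop (𝓝 0) :=
    squeeze_zero' (Eventually.of_forall fun n => graphFreq_nonneg _) h hδ
  have h1 := h0.const_sub 1
  rw [sub_zero] at h1
  exact h1.congr fun n => (graphFreq_not (P n)).symm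

theorem almostAllGraphs_of_forall {P : ∀ n : ℕ, SimpleGraph (Fin n) → Prop} (h : ∀ n G, P n G) :
    AlmostAllGraphs P :=
  almostAllGraphs_of_graphFreq_le tendsto_const_nhds
    (Eventually.of_forall fun n => by simp [graphFreq, h])

theorem AlmostAllGraphs.tendsto_graphFreq_not {P : ∀ n : ℕ, SimpleGraph (Fin n) → Prop}
    (h : AlmostAllGraphs P) : Tendsto (fun n => graphFreq fun G => ¬ P n G) atTop (𝓝 0) := by
  have h1 : Tendsto (fun n => 1 - graphFreq (P n)) atTop (𝓝 (1 - 1)) := Tendsto.const_sub 1 h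
  rw [sub_self] at h1
  exact h1.congr fun n => by rw [graphFreq_not (P n)]; ring

theorem AlmostAllGraphs.and {P Q : ∀ n : ℕ, SimpleGraph (Fin n) → Prop}
    (hP : AlmostAllGraphs P) (hQ : AlmostAllGraphs Q) :
    AlmostAllGraphs fun n G => P n G ∧ Q n G := by
  have h := hP.tendsto_graphFreq_not.add hQ.tendsto_graphFreq_not
  rw [add_zero] at h
  refine almostAllGraphs_of_graphFreq_le h (Eventually.of_forall fun n => ?_)
  exact (graphFreq_mono fun G hG => not_and_or.mp hG).trans (graphFreq_or_le _ _)

theorem AlmostAllGraphs.mono {P Q : ∀ n : ℕ, SimpleGraph (Fin n) → Prop}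
    (hP : AlmostAllGraphs P) (h : ∀ᶠ n in atTop, ∀ G, P n G → Q n G) : AlmostAllGraphs Q :=
  almostAllGraphs_of_graphFreq_le hP.tendsto_graphFreq_not
    (h.mono fun _ hn => graphFreq_mono fun G hG hPG => hG (hn G hPG))

end AlmostAll

/-! ### Flipping the edges at one vertex -/

section Star

variable {V : Type*}

/-- The star with centre `v` and leaf set `D`, where `v` itself is disregarded if it lies in `D`. -/
def starGraph (v : V) (D : Finset V) : SimpleGraph V where
  Adj x y := x ≠ y ∧ ((x = v ∧ y ∈ D) ∨ (y = v ∧ x ∈ D))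
  symm := ⟨fun _ _ h => ⟨h.1.symm, h.2.symm⟩⟩
  loopless := ⟨fun _ h => h.1 rfl⟩

theorem symmDiff_adj_iff {G H : SimpleGraph V} {x y : V} :
    (symmDiff G H).Adj x y ↔ ¬ (G.Adj x y ↔ H.Adj x y) := by
  simp only [symmDiff, SimpleGraph.sup_adj, SimpleGraph.sdiff_adj]
  tauto

theorem symmDiff_starGraph_adj_center {G : SimpleGraph V} {v w : V} {D : Finset V} (h : v ≠ w) :
    (symmDiff G (starGraph v D)).Adj v w ↔ ¬ (G.Adj v w ↔ w ∈ D) := by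
  rw [symmDiff_adj_iff]
  simp [starGraph, h, h.symm]

theorem symmDiff_starGraph_adj_of_ne {G : SimpleGraph V} {v x y : V} {D : Finset V}
    (hx : x ≠ v) (hy : y ≠ v) : (symmDiff G (starGraph v D)).Adj x y ↔ G.Adj x y := by
  rw [symmDiff_adj_iff]
  simp [starGraph, hx, hy]

variable [Fintype V]

/-- A Chernoff bound: weigh a set `D` by `2 ^ (d - |D|)`. -/
theorem card_filter_card_le_le (d : ℕ) :
    ((Finset.univ.filter fun D : Finset V => D.card ≤ d).card : ℝ) ≤
      2 ^ d * (3 / 2) ^ Fintype.card V := by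
  have h1 : ∑ D : Finset V, (1 / 2 : ℝ) ^ D.card = (3 / 2) ^ Fintype.card V := by
    have := Fintype.sum_pow_mul_eq_add_pow V (1 / 2 : ℝ) 1
    norm_num at this ⊢
    exact this
  rw [← h1, Finset.mul_sum, Finset.card_filter, Nat.cast_sum]
  refine Finset.sum_le_sum fun D _ => ?_
  split_ifs with h
  · have h2 : (1 / 2 : ℝ) ^ d ≤ (1 / 2) ^ D.card :=
      pow_le_pow_of_le_one (by norm_num) (by norm_num) h
    calc ((1 : ℕ) : ℝ) = 2 ^ d * (1 / 2) ^ d := by rw [← mul_pow]; norm_num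
      _ ≤ _ := by gcongr
  · simp only [Nat.cast_zero]; positivity

variable [DecidableEq V]

/-- The sets `D` with a prescribed trace on `W` make up a proportion `2 ^ (-|W|)` of all sets. -/
theorem card_filter_forall_mem_iff_le (W : Finset V) (p : V → Prop) [DecidablePred p] :
    ((Finset.univ.filter fun D : Finset V => ∀ w ∈ W, (w ∈ D ↔ p w)).card : ℝ) ≤
      (1 / 2) ^ W.card * Fintype.card (Finset V) := by
  have h : (Finset.univ.filter fun D : Finset V => ∀ w ∈ W, (w ∈ D ↔ p w)).card ≤
      2 ^ (Wᶜ).card := by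
    rw [← Finset.card_powerset]
    refine Finset.card_le_card_of_injOn (fun D => D \ W) (fun D _ => ?_) fun D hD E hE hDE => ?_
    · simp only [Finset.coe_powerset, Set.mem_preimage, Set.mem_powerset_iff, Finset.coe_subset]
      intro w hw
      simpa using (Finset.mem_sdiff.mp hw).2
    · simp only [Finset.coe_filter, Finset.mem_univ, true_and, Set.mem_ofPred_eq] at hD hE
      ext w
      by_cases hw : w ∈ W
      · rw [hD w hw, hE w hw]
      · have := congrArg (w ∈ ·) hDE
        simpa [hw] using this
  have h2 : (1 / 2 : ℝ) ^ W.card * Fintype.card (Finset V) = 2 ^ (Wᶜ).card := by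
    rw [Fintype.card_finset, Finset.card_compl, ← Nat.add_sub_of_le W.card_le_univ,
      Nat.add_sub_cancel_left]
    push_cast
    rw [pow_add, ← mul_assoc, ← mul_pow]
    norm_num
  rw [h2]
  exact_mod_cast h

/-- Two given vertices outside `W` have the same neighbours in `W` with probability at most
`2 ^ (-|W|)`. -/
theorem graphFreq_forall_adj_iff_le {W : Finset V} {u v : V} (huv : u ≠ v) (hu : u ∉ W)
    (hv : v ∉ W) :
    graphFreq (fun G : SimpleGraph V => ∀ w ∈ W, (G.Adj u w ↔ G.Adj v w)) ≤ (1 / 2) ^ W.card := by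
  classical
  refine graphFreq_le_of_flip (starGraph u) _ _ fun G => ?_
  refine le_trans ?_ (card_filter_forall_mem_iff_le W fun w => ¬ (G.Adj u w ↔ G.Adj v w))
  refine Nat.cast_le.mpr (Finset.card_le_card fun D hD => ?_)
  rw [Finset.mem_filter] at hD ⊢
  refine ⟨hD.1, fun w hw => ?_⟩
  have h := hD.2
  have hwu : u ≠ w := fun e => hu (e ▸ hw)
  have hwv : v ≠ w := fun e => hv (e ▸ hw)
  have := h w hw
  rw [symmDiff_starGraph_adj_center hwu, symmDiff_starGraph_adj_of_ne huv.symm hwu.symm] at this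
  tauto

open Classical in
/-- Given the neighbours of `u`, a further vertex `v` misses all of them with exponentially small
probability. -/
theorem graphFreq_forall_not_adj_le {u v : V} (huv : u ≠ v) (d : ℕ) :
    graphFreq (fun G : SimpleGraph V => d < (Finset.univ.filter (G.Adj u)).card ∧
      ∀ w, ¬ (G.Adj u w ∧ G.Adj v w)) ≤ (1 / 2) ^ d := by
  refine graphFreq_le_of_flip (starGraph v) _ _ fun G => ?_
  set T : Finset V := (Finset.univ.filter (G.Adj u)).erase v with hT
  by_cases hd : d ≤ T.card
  · have h1 := card_filter_forall_mem_iff_le T (G.Adj v)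
    have h2 : (1 / 2 : ℝ) ^ T.card ≤ (1 / 2) ^ d :=
      pow_le_pow_of_le_one (by norm_num) (by norm_num) hd
    refine le_trans ?_ (h1.trans (by gcongr))
    refine Nat.cast_le.mpr (Finset.card_le_card fun D hD => ?_)
    rw [Finset.mem_filter] at hD ⊢
    refine ⟨hD.1, fun w hw => ?_⟩
    have h := hD.2.2
    simp only [hT, Finset.mem_erase, Finset.mem_filter, Finset.mem_univ, true_and] at hw
    have := h w
    rw [symmDiff_starGraph_adj_center hw.1.symm, symmDiff_starGraph_adj_of_ne huv hw.1] at this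
    tauto
  · rw [Finset.card_eq_zero.mpr, Nat.cast_zero]
    · positivity
    · refine Finset.filter_eq_empty_iff.mpr ?_
      rintro D - ⟨h, -⟩
      refine hd ?_
      have hsub : (Finset.univ.filter ((symmDiff G (starGraph v D)).Adj u)).erase v ⊆ T := by
        intro w hw
        simp only [hT, Finset.mem_erase, Finset.mem_filter, Finset.mem_univ, true_and] at hw ⊢
        exact ⟨hw.1, (symmDiff_starGraph_adj_of_ne huv hw.1).mp hw.2⟩
      have h1 := Finset.card_le_card hsub
      have h2 := Finset.pred_card_le_card_erase
        (s := Finset.univ.filter ((symmDiff G (starGraph v D)).Adj u)) (a := v)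
      omega

open Classical in
theorem graphFreq_degree_lt_le (v : V) (d : ℕ) :
    graphFreq (fun G : SimpleGraph V => (Finset.univ.filter (G.Adj v)).card < d) ≤
      2 ^ d * (3 / 4) ^ Fintype.card V := by
  refine graphFreq_le_of_flip (starGraph v) _ _ fun G => ?_
  have h2 : (2 ^ d * (3 / 4) ^ Fintype.card V : ℝ) * Fintype.card (Finset V)
      = 2 ^ d * (3 / 2) ^ Fintype.card V := by
    rw [Fintype.card_finset]
    push_cast
    rw [mul_assoc, ← mul_pow]
    norm_num
  rw [h2]
  refine le_trans ?_ (card_filter_card_le_le (V := V) d)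
  norm_cast
  refine Finset.card_le_card_of_injOn
    (fun D => symmDiff D (Finset.univ.filter (G.Adj v))) (fun D hD => ?_)
    fun D _ E _ h => symmDiff_left_injective _ h
  simp only [Finset.coe_filter, Finset.mem_univ, true_and, Set.mem_ofPred_eq] at hD ⊢
  -- the vertex `v` may lie in `D`, which costs one element
  have hsub : symmDiff D (Finset.univ.filter (G.Adj v)) ⊆
      insert v (Finset.univ.filter ((symmDiff G (starGraph v D)).Adj v)) := by
    intro w hw
    by_cases hwv : w = v
    · simp [hwv]
    · refine Finset.mem_insert_of_mem ?_
      simp only [Finset.mem_filter, Finset.mem_univ, true_and,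
        symmDiff_starGraph_adj_center (Ne.symm hwv)]
      simp only [Finset.mem_symmDiff, Finset.mem_filter, Finset.mem_univ, true_and] at hw
      tauto
  have h3 := (Finset.card_le_card hsub).trans (Finset.card_insert_le _ _)
  omega

end Star

/-! ### The birthday bound -/

section Birthday

theorem descFactorial_le_pow_mul_exp (N t : ℕ) (hN : 0 < N) :
    (N.descFactorial t : ℝ) ≤ N ^ t * Real.exp (-(t * (t - 1) / (2 * N))) := by
  have hN' : (0 : ℝ) < N := by exact_mod_cast hN
  induction t with
  | zero => simp
  | succ t ih =>
    have h1 : ((N - t : ℕ) : ℝ) ≤ N * Real.exp (-(t / N)) := by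
      have h2 := Real.add_one_le_exp (-(t / N : ℝ))
      rcases le_total t N with h | h
      · rw [Nat.cast_sub h]
        calc (N : ℝ) - t = N * (-(t / N) + 1) := by field_simp; ring
          _ ≤ _ := by gcongr
      · rw [Nat.sub_eq_zero_of_le h, Nat.cast_zero]
        positivity
    rw [Nat.descFactorial_succ]
    push_cast
    calc ((N - t : ℕ) : ℝ) * N.descFactorial t
        ≤ (N * Real.exp (-(t / N))) * (N ^ t * Real.exp (-(t * (t - 1) / (2 * N)))) := by gcongr
      _ = N ^ (t + 1) * (Real.exp (-(t / N)) * Real.exp (-(t * (t - 1) / (2 * N)))) := by ring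
      _ = _ := by
        rw [← Real.exp_add]
        congr 2
        field_simp
        ring

open Classical in
/-- A random function is injective on a `t`-set with probability at most `exp (-t(t-1)/2N)`, where
`N` is the number of values. -/
theorem card_filter_injOn_le {V α : Type*} [Fintype V] [DecidableEq V] [Fintype α] [Nonempty α]
    (T : Finset V) :
    ((Finset.univ.filter fun f : V → α => Set.InjOn f T).card : ℝ) ≤
      Real.exp (-(T.card * (T.card - 1) / (2 * Fintype.card α))) * Fintype.card (V → α) := by
  have h : (Finset.univ.filter fun f : V → α => Set.InjOn f T).card ≤
      Fintype.card ((T ↪ α) × ({v // v ∉ T} → α)) := by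
    rw [← Fintype.card_subtype]
    refine Fintype.card_le_of_injective
      (fun f => (⟨fun v => f.1 v, fun a b hab => Subtype.ext (f.2 a.2 b.2 hab)⟩, fun v => f.1 v))
      fun f g hfg => Subtype.ext (funext fun v => ?_)
    simp only [Prod.mk.injEq] at hfg
    by_cases hv : v ∈ T
    · exact DFunLike.congr_fun hfg.1 ⟨v, hv⟩
    · exact congrFun hfg.2 ⟨v, hv⟩
  have hcard : Fintype.card V = T.card + Fintype.card {v // v ∉ T} := by
    rw [Fintype.card_subtype_compl, Fintype.card_coe]
    have := T.card_le_univ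
    omega
  have h1 := descFactorial_le_pow_mul_exp (Fintype.card α) T.card Fintype.card_pos
  calc ((Finset.univ.filter fun f : V → α => Set.InjOn f T).card : ℝ)
      ≤ ((Fintype.card ((T ↪ α) × ({v // v ∉ T} → α)) : ℕ) : ℝ) := by exact_mod_cast h
    _ = (Fintype.card α).descFactorial T.card *
        (Fintype.card α : ℝ) ^ Fintype.card {v // v ∉ T} := by
      rw [Fintype.card_prod, Fintype.card_embedding_eq, Fintype.card_fun, Fintype.card_coe]
      push_cast
      rfl
    _ ≤ _ := by
      rw [Fintype.card_fun, hcard]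
      push_cast
      rw [pow_add]
      calc _ ≤ ((Fintype.card α : ℝ) ^ T.card *
            Real.exp (-(T.card * (T.card - 1) / (2 * Fintype.card α)))) *
            (Fintype.card α : ℝ) ^ Fintype.card {v // v ∉ T} := by gcongr
        _ = _ := by ring

end Birthday

section Bipartite

variable {V : Type*}

/-- The graph of the edges between `W` and its complement in which `v ∉ W` is joined to the
elements of `b v`. -/
def crossGraph (W : Finset V) (b : V → Finset W) : SimpleGraph V where
  Adj x y := (x ∉ W ∧ ∃ h : y ∈ W, ⟨y, h⟩ ∈ b x) ∨ (y ∉ W ∧ ∃ h : x ∈ W, ⟨x, h⟩ ∈ b y)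
  symm := ⟨fun _ _ h => h.symm⟩
  loopless := ⟨fun _ h => by
    rcases h with ⟨h, h', -⟩ | ⟨h, h', -⟩ <;> exact h h'⟩

theorem symmDiff_crossGraph_adj_of_notMem {G : SimpleGraph V} {W : Finset V} {b : V → Finset W}
    {x y : V} (hx : x ∉ W) (hy : y ∉ W) : (symmDiff G (crossGraph W b)).Adj x y ↔ G.Adj x y := by
  rw [symmDiff_adj_iff]
  simp [crossGraph, hx, hy]

theorem symmDiff_crossGraph_adj_of_mem {G : SimpleGraph V} {W : Finset V} {b : V → Finset W}
    {x : V} (hx : x ∉ W) (w : W) :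
    (symmDiff G (crossGraph W b)).Adj x w ↔ ¬ (G.Adj x w ↔ w ∈ b x) := by
  rw [symmDiff_adj_iff]
  simp [crossGraph, hx]

variable [Fintype V] [DecidableEq V]

open Classical in
/-- The neighbours outside `W` of a vertex `u ∉ W` do not depend on the edges between `W` and its
complement, so the birthday bound applies to their neighbourhoods in `W`. -/
theorem graphFreq_injOn_le {u : V} {W : Finset V} (hu : u ∉ W) (t : ℕ) :
    graphFreq (fun G : SimpleGraph V => t ≤ (Finset.univ.filter (G.Adj u) \ W).card ∧
      ∀ a b, G.Adj u a → G.Adj u b → a ∉ W → b ∉ W →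
        (∀ w ∈ W, (G.Adj a w ↔ G.Adj b w)) → a = b) ≤
      Real.exp (-(t * (t - 1) / (2 * 2 ^ W.card))) := by
  refine graphFreq_le_of_flip (crossGraph W) _ _ fun G => ?_
  set T : Finset V := Finset.univ.filter (G.Adj u) \ W with hT
  have hTmem : ∀ v, v ∈ T ↔ G.Adj u v ∧ v ∉ W := fun v => by simp [hT]
  have hTeq : ∀ b, Finset.univ.filter ((symmDiff G (crossGraph W b)).Adj u) \ W = T := by
    intro b
    ext v
    rw [hTmem]
    simp only [Finset.mem_sdiff, Finset.mem_filter, Finset.mem_univ, true_and]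
    exact and_congr_left fun hv => symmDiff_crossGraph_adj_of_notMem hu hv
  simp only [hTeq]
  by_cases ht : t ≤ T.card
  · have h1 := card_filter_injOn_le (α := Finset W) T
    have h2 : Real.exp (-(T.card * (T.card - 1) / (2 * Fintype.card (Finset W)))) ≤
        Real.exp (-(t * (t - 1) / (2 * 2 ^ W.card))) := by
      rw [Fintype.card_finset, Fintype.card_coe]
      push_cast
      refine Real.exp_le_exp.mpr (neg_le_neg ?_)
      gcongr ?_ / _
      rcases Nat.eq_zero_or_pos t with rfl | h0
      · rcases Nat.eq_zero_or_pos T.card with h | h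
        · simp [h]
        · have : (1 : ℝ) ≤ T.card := by exact_mod_cast h
          simp only [CharP.cast_eq_zero, zero_mul]
          exact mul_nonneg (by positivity) (by linarith)
      · have h3 : (1 : ℝ) ≤ t := by exact_mod_cast h0
        have h4 : (t : ℝ) ≤ T.card := by exact_mod_cast ht
        exact mul_le_mul h4 (by linarith) (by linarith) (by linarith)
    refine le_trans ?_ (h1.trans (by gcongr))
    refine Nat.cast_le.mpr ?_
    let S : V → Finset W := fun v => Finset.univ.filter fun w : W => G.Adj v w
    refine Finset.card_le_card_of_injOn (fun b v => symmDiff (b v) (S v)) (fun b hb => ?_)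
      fun b _ c _ h => funext fun v => symmDiff_left_injective _ (congrFun h v)
    simp only [Finset.coe_filter, Finset.mem_univ, true_and, Set.mem_ofPred_eq] at hb ⊢
    intro x hx y hy hxy
    rw [Finset.mem_coe, hTmem] at hx hy
    refine hb.2 x y ((symmDiff_crossGraph_adj_of_notMem hu hx.2).mpr hx.1)
      ((symmDiff_crossGraph_adj_of_notMem hu hy.2).mpr hy.1) hx.2 hy.2 fun w hw => ?_
    have h5 := Finset.ext_iff.mp hxy ⟨w, hw⟩
    have hx' := symmDiff_crossGraph_adj_of_mem (G := G) (b := b) hx.2 ⟨w, hw⟩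
    have hy' := symmDiff_crossGraph_adj_of_mem (G := G) (b := b) hy.2 ⟨w, hw⟩
    simp only at hx' hy'
    rw [hx', hy']
    simp only [Finset.mem_symmDiff, S, Finset.mem_filter, Finset.mem_univ, true_and] at h5
    clear * - h5
    grind
  · rw [Finset.card_eq_zero.mpr (Finset.filter_eq_empty_iff.mpr fun b _ h => ht h.1), Nat.cast_zero]
    positivity

end Bipartite

/-! ### Properties of almost all graphs -/

section AlmostAllProperties

open Classical in
theorem almostAllGraphs_degree : AlmostAllGraphs fun n G =>
    ∀ v, n / 4 ≤ (Finset.univ.filter (G.Adj v)).card := by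
  refine almostAllGraphs_of_graphFreq_le (δ := fun n : ℕ => n * (15 / 16 : ℝ) ^ n)
    (tendsto_self_mul_const_pow_of_lt_one (by norm_num) (by norm_num))
    (Eventually.of_forall fun n => ?_)
  have h1 : ∀ v : Fin n, graphFreq (fun G : SimpleGraph (Fin n) =>
      (Finset.univ.filter (G.Adj v)).card < n / 4) ≤ (15 / 16 : ℝ) ^ n := by
    intro v
    have h := graphFreq_degree_lt_le v (n / 4)
    rw [Fintype.card_fin] at h
    refine h.trans ?_
    -- `2 ≤ (5 / 4) ^ 4`, and `5 / 4 * (3 / 4) = 15 / 16 < 1`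
    have h2 : (2 : ℝ) ^ (n / 4) ≤ (5 / 4) ^ n := by
      calc (2 : ℝ) ^ (n / 4) ≤ ((5 / 4) ^ 4) ^ (n / 4) := by gcongr; norm_num
        _ = (5 / 4) ^ (4 * (n / 4)) := by rw [← pow_mul]
        _ ≤ _ := pow_le_pow_right₀ (by norm_num) (by omega)
    calc (2 : ℝ) ^ (n / 4) * (3 / 4) ^ n ≤ (5 / 4) ^ n * (3 / 4) ^ n := by gcongr
      _ = (15 / 16) ^ n := by rw [← mul_pow]; norm_num
  have h3 := graphFreq_exists_mem_le (Finset.univ : Finset (Fin n)) _ _ fun v _ => h1 v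
  rw [Finset.card_univ, Fintype.card_fin] at h3
  exact (graphFreq_mono fun G hG => by simpa using hG).trans h3

theorem almostAllGraphs_exists_common_neighbor : AlmostAllGraphs fun _ G =>
    ∀ u v, u ≠ v → ∃ w, G.Adj u w ∧ G.Adj v w := by
  classical
  have hlim : Tendsto (fun n : ℕ => 4 * ((n : ℝ) ^ 2 * (9 / 10 : ℝ) ^ n)) atTop (𝓝 0) := by
    simpa using (tendsto_pow_const_mul_const_pow_of_abs_lt_one 2
      (r := (9 / 10 : ℝ)) (by norm_num [abs_of_pos])).const_mul 4
  have hdeg := almostAllGraphs_degree.tendsto_graphFreq_not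
  have hsum := hdeg.add hlim
  rw [add_zero] at hsum
  refine almostAllGraphs_of_graphFreq_le hsum ?_
  filter_upwards [eventually_ge_atTop 8] with n hn
  let I : Finset (Fin n × Fin n) := Finset.univ.filter fun p => p.1 ≠ p.2
  have h1 : ∀ p ∈ I, graphFreq (fun G : SimpleGraph (Fin n) =>
      n / 4 - 1 < (Finset.univ.filter (G.Adj p.1)).card ∧ ∀ w, ¬ (G.Adj p.1 w ∧ G.Adj p.2 w)) ≤
        4 * (9 / 10 : ℝ) ^ n := by
    intro p hp
    refine (graphFreq_forall_not_adj_le (by simpa [I] using hp) _).trans ?_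
    -- `1 / 2 ≤ (9 / 10) ^ 4`; rounding and the `- 1` cost at most seven factors `9 / 10`
    calc (1 / 2 : ℝ) ^ (n / 4 - 1) ≤ ((9 / 10) ^ 4) ^ (n / 4 - 1) := by gcongr; norm_num
      _ = (9 / 10) ^ (4 * (n / 4 - 1)) := by rw [← pow_mul]
      _ ≤ (9 / 10) ^ (n - 7) :=
        pow_le_pow_of_le_one (by norm_num) (by norm_num) (by omega)
      _ = (10 / 9) ^ 7 * ((9 / 10) ^ 7 * (9 / 10) ^ (n - 7)) := by
        rw [← mul_assoc, ← mul_pow]; norm_num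
      _ = (10 / 9) ^ 7 * (9 / 10) ^ n := by rw [← pow_add, Nat.add_sub_of_le (by omega)]
      _ ≤ 4 * (9 / 10 : ℝ) ^ n := by gcongr; norm_num
  have h3 := graphFreq_exists_mem_le I _ _ h1
  have hI : (I.card : ℝ) ≤ n ^ 2 := by
    have := Finset.card_le_univ I
    rw [Fintype.card_prod, Fintype.card_fin, ← pow_two] at this
    exact_mod_cast this
  have h4 : (I.card : ℝ) * (4 * (9 / 10 : ℝ) ^ n) ≤ 4 * ((n : ℝ) ^ 2 * (9 / 10 : ℝ) ^ n) := by
    calc _ ≤ (n : ℝ) ^ 2 * (4 * (9 / 10 : ℝ) ^ n) := by gcongr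
      _ = _ := by ring
  refine le_trans ?_ (add_le_add le_rfl (h3.trans h4))
  refine le_trans (graphFreq_mono fun G hG => ?_) (graphFreq_or_le _ _)
  by_cases hd : ∀ v, n / 4 ≤ (Finset.univ.filter (G.Adj v)).card
  · right
    push Not at hG
    obtain ⟨u, v, huv, hw⟩ := hG
    refine ⟨(u, v), by simpa [I] using huv, ?_, fun w h => hw w h.1 h.2⟩
    exact lt_of_lt_of_le (by omega) (hd u)
  · exact Or.inl hd

/-- In almost all graphs, for every `k`-set `W` with `k` about `(1 - ε) 2 log₂ n` and every vertex
`u ∉ W`, some two neighbours of `u` outside `W` have the same neighbours in `W`: the `n / 4` or more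
neighbours of `u` have only `2 ^ k ≤ n ^ (2 - 2ε)` possible neighbourhoods in `W`, and the failure
probability `exp (-Ω(n ^ 2ε))` of the birthday bound beats the number `exp (O(log² n))` of the pairs
`(u, W)`. -/
theorem almostAllGraphs_exists_same_neighbors {ε : ℝ} (hε : 0 < ε) (hε1 : ε < 1) :
    AlmostAllGraphs fun n G => ∀ (u : Fin n) (W : Finset (Fin n)),
      W.card = ⌊(1 - ε) * (2 * Real.log n / Real.log 2)⌋₊ → u ∉ W →
      ∃ a b, G.Adj u a ∧ G.Adj u b ∧ a ≠ b ∧ a ∉ W ∧ b ∉ W ∧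
        ∀ w ∈ W, (G.Adj a w ↔ G.Adj b w) := by
  classical
  have hlog : Tendsto (fun n : ℕ => Real.log n) atTop atTop :=
    Real.tendsto_log_atTop.comp tendsto_natCast_atTop_atTop
  have hlim : Tendsto (fun n : ℕ => Real.exp (-Real.log n)) atTop (𝓝 0) :=
    Real.tendsto_exp_neg_atTop_nhds_zero.comp hlog
  have hsum := almostAllGraphs_degree.tendsto_graphFreq_not.add hlim
  rw [add_zero] at hsum
  refine almostAllGraphs_of_graphFreq_le hsum ?_
  -- the exponent gained from the birthday bound dominates the `log² n` of the union bound
  have hexp : ∀ᶠ n : ℕ in atTop,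
      Real.log n ^ 2 ≤ 1 / 2048 * Real.exp (2 * ε * Real.log n) := by
    have := (isLittleO_pow_exp_pos_mul_atTop 2 (b := 2 * ε) (by positivity)).def
      (show (0 : ℝ) < 1 / 2048 by norm_num)
    filter_upwards [hlog.eventually this] with n hn
    simpa [abs_of_pos (Real.exp_pos _)] using hn
  have hlin : ∀ᶠ n : ℕ in atTop, Real.log n ≤ 1 / 32 * n := by
    have := Real.isLittleO_log_id_atTop.def (show (0 : ℝ) < 1 / 32 by norm_num)
    filter_upwards [tendsto_natCast_atTop_atTop.eventually this] with n hn
    simp only [Real.norm_eq_abs, id, Nat.abs_cast] at hn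
    exact (le_abs_self _).trans hn
  filter_upwards [hexp, hlin, hlog.eventually_ge_atTop 1, eventually_ge_atTop 64]
    with n hexp hlin hlog1 hn
  set k := ⌊(1 - ε) * (2 * Real.log n / Real.log 2)⌋₊ with hk
  have hn' : (64 : ℝ) ≤ n := by exact_mod_cast hn
  have hnpos : (0 : ℝ) < n := by linarith
  have hl2 : 0 < Real.log 2 := Real.log_pos (by norm_num)
  have hk0 : (k : ℝ) ≤ (1 - ε) * (2 * Real.log n / Real.log 2) :=
    Nat.floor_le (mul_nonneg (by linarith) (by positivity))
  have hkmul : k * Real.log 2 ≤ (1 - ε) * (2 * Real.log n) := by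
    calc k * Real.log 2 ≤ (1 - ε) * (2 * Real.log n / Real.log 2) * Real.log 2 := by gcongr
      _ = _ := by field_simp
  have hk3 : (k : ℝ) ≤ 3 * Real.log n := by
    have h1 : (1 - ε) * (2 * Real.log n) ≤ 2 * Real.log n := by nlinarith
    have h2 := Real.log_two_gt_d9
    have h3 : (k : ℝ) * 0.69 ≤ k * Real.log 2 := by
      have : (0 : ℝ) ≤ k := by positivity
      nlinarith
    linarith
  have h2k : (2 : ℝ) ^ k ≤ n ^ 2 * Real.exp (-(2 * ε * Real.log n)) := by
    calc (2 : ℝ) ^ k = Real.exp (k * Real.log 2) := by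
          rw [Real.exp_nat_mul, Real.exp_log (by norm_num)]
      _ ≤ Real.exp (2 * Real.log n + -(2 * ε * Real.log n)) :=
        Real.exp_le_exp.mpr (by linarith)
      _ = _ := by
        rw [Real.exp_add, two_mul, Real.exp_add, Real.exp_log hnpos, pow_two]
  set t := n / 4 - k with ht
  have ht8 : (n : ℝ) / 8 ≤ t := by
    have h1 : n ≤ 4 * (t + k) + 3 := by omega
    have h2 : (n : ℝ) ≤ 4 * (t + k) + 3 := by exact_mod_cast h1
    linarith
  have hexpo : Real.exp (2 * ε * Real.log n) / 256 ≤ t * (t - 1) / (2 * 2 ^ k) := by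
    rw [le_div_iff₀ (by positivity)]
    have h1 : (n : ℝ) / 8 * (n / 16) ≤ t * (t - 1) :=
      mul_le_mul ht8 (by linarith) (by positivity) (by positivity)
    calc Real.exp (2 * ε * Real.log n) / 256 * (2 * 2 ^ k)
        ≤ Real.exp (2 * ε * Real.log n) / 256 *
          (2 * (n ^ 2 * Real.exp (-(2 * ε * Real.log n)))) := by gcongr
      _ = n ^ 2 / 128 * (Real.exp (2 * ε * Real.log n) * Real.exp (-(2 * ε * Real.log n))) := by
        ring
      _ = (n : ℝ) / 8 * (n / 16) := by
        rw [← Real.exp_add, add_neg_cancel, Real.exp_zero]; ring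
      _ ≤ _ := h1
  -- the union bound over all pairs `(u, W)` with `u ∉ W`
  let I : Finset (Fin n × Finset (Fin n)) :=
    (Finset.univ ×ˢ Finset.powersetCard k Finset.univ).filter fun p => p.1 ∉ p.2
  have hI : (I.card : ℝ) ≤ Real.exp ((k + 1 : ℕ) * Real.log n) := by
    have h1 : I.card ≤ n ^ (k + 1) := by
      refine (Finset.card_filter_le _ _).trans ?_
      rw [Finset.card_product, Finset.card_powersetCard, Finset.card_univ, Fintype.card_fin,
        pow_succ']
      exact Nat.mul_le_mul le_rfl (Nat.choose_le_pow _ _)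
    rw [Real.exp_nat_mul, Real.exp_log hnpos]
    exact_mod_cast h1
  have h1 : ∀ p ∈ I, graphFreq (fun G : SimpleGraph (Fin n) =>
      t ≤ (Finset.univ.filter (G.Adj p.1) \ p.2).card ∧
      ∀ a b, G.Adj p.1 a → G.Adj p.1 b → a ∉ p.2 → b ∉ p.2 →
        (∀ w ∈ p.2, (G.Adj a w ↔ G.Adj b w)) → a = b) ≤
      Real.exp (-(Real.exp (2 * ε * Real.log n) / 256)) := by
    rintro ⟨u, W⟩ hp
    simp only [I, Finset.mem_filter, Finset.mem_product, Finset.mem_univ, true_and,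
      Finset.mem_powersetCard_univ] at hp
    refine (graphFreq_injOn_le hp.2 t).trans (Real.exp_le_exp.mpr (neg_le_neg ?_))
    rw [hp.1]
    exact hexpo
  have h3 := graphFreq_exists_mem_le I _ _ h1
  have h4 : (I.card : ℝ) * Real.exp (-(Real.exp (2 * ε * Real.log n) / 256)) ≤
      Real.exp (-Real.log n) := by
    calc _ ≤ Real.exp ((k + 1 : ℕ) * Real.log n) *
          Real.exp (-(Real.exp (2 * ε * Real.log n) / 256)) := by gcongr
      _ ≤ _ := by
        rw [← Real.exp_add]
        refine Real.exp_le_exp.mpr ?_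
        push_cast
        have h5 : (k : ℝ) * Real.log n ≤ 3 * Real.log n * Real.log n := by gcongr
        nlinarith
  refine le_trans ?_ (add_le_add le_rfl (h3.trans h4))
  refine le_trans (graphFreq_mono fun G hG => ?_) (graphFreq_or_le _ _)
  by_cases hd : ∀ v, n / 4 ≤ (Finset.univ.filter (G.Adj v)).card
  · right
    by_contra! hcon
    refine hG fun u W hW hu => ?_
    by_contra! hab
    have hsize : t ≤ (Finset.univ.filter (G.Adj u) \ W).card := by
      have := hd u
      have := Finset.le_card_sdiff W (Finset.univ.filter (G.Adj u))
      omega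
    obtain ⟨a, b, hua, hub, haW, hbW, hw, hne⟩ := hcon (u, W) (by simp [I, hW, hu]) hsize
    obtain ⟨w, hw', hw''⟩ := hab a b hua hub hne haW hbW
    have := hw w hw'
    tauto
  · exact Or.inl hd

theorem almostAllGraphs_localizationNumber_le (mayStay : Bool) {ε : ℝ} (hε : 0 < ε) :
    AlmostAllGraphs fun n G =>
      (localizationNumber G mayStay : ℝ) ≤ (1 + ε) * (2 * Real.log n / Real.log 2) := by
  have hlog : Tendsto (fun n : ℕ => Real.log n) atTop atTop :=
    Real.tendsto_log_atTop.comp tendsto_natCast_atTop_atTop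
  have hlim : Tendsto (fun n : ℕ => 2 * Real.exp (-(2 * ε * Real.log n))) atTop (𝓝 0) := by
    have := (Real.tendsto_exp_neg_atTop_nhds_zero.comp
      (hlog.const_mul_atTop (show 0 < 2 * ε by positivity))).const_mul 2
    simpa using this
  refine almostAllGraphs_of_graphFreq_le hlim ?_
  have hlin : ∀ᶠ n : ℕ in atTop, (1 + ε) * (2 * Real.log n / Real.log 2) ≤ n := by
    have hc : 0 < 1 / ((1 + ε) * (2 / Real.log 2)) := by
      have := Real.log_pos (show (1 : ℝ) < 2 by norm_num)
      positivity
    have := Real.isLittleO_log_id_atTop.def hc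
    filter_upwards [tendsto_natCast_atTop_atTop.eventually this] with n hn
    simp only [Real.norm_eq_abs, id, Nat.abs_cast] at hn
    have h1 := (le_abs_self _).trans hn
    rw [one_div, inv_mul_eq_div, le_div_iff₀ (one_div_pos.mp hc)] at h1
    calc _ = Real.log n * ((1 + ε) * (2 / Real.log 2)) := by ring
      _ ≤ _ := h1
  filter_upwards [hlin, eventually_ge_atTop 1] with n hlin hn
  set k := ⌊(1 + ε) * (2 * Real.log n / Real.log 2)⌋₊ with hk
  have hnpos : (0 : ℝ) < n := by exact_mod_cast hn
  have hl2 : 0 < Real.log 2 := Real.log_pos (by norm_num)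
  have hlogn : 0 ≤ Real.log n := Real.log_natCast_nonneg n
  have hk0 : (k : ℝ) ≤ (1 + ε) * (2 * Real.log n / Real.log 2) := Nat.floor_le (by positivity)
  have hkn : k ≤ n := by exact_mod_cast hk0.trans hlin
  obtain ⟨W, -, hW⟩ := Finset.exists_subset_card_eq
    (show k ≤ (Finset.univ : Finset (Fin n)).card by simpa using hkn)
  let I : Finset (Fin n × Fin n) := Finset.univ.filter fun p => p.1 ≠ p.2 ∧ p.1 ∉ W ∧ p.2 ∉ W
  have h1 : ∀ p ∈ I, graphFreq (fun G : SimpleGraph (Fin n) =>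
      ∀ w ∈ W, (G.Adj p.1 w ↔ G.Adj p.2 w)) ≤ (1 / 2) ^ k := by
    intro p hp
    simp only [I, Finset.mem_filter, Finset.mem_univ, true_and] at hp
    rw [← hW]
    exact graphFreq_forall_adj_iff_le hp.1 hp.2.1 hp.2.2
  have h3 := graphFreq_exists_mem_le I _ _ h1
  have hI : (I.card : ℝ) ≤ n ^ 2 := by
    have := Finset.card_le_univ I
    rw [Fintype.card_prod, Fintype.card_fin, ← pow_two] at this
    exact_mod_cast this
  have hpow : (1 / 2 : ℝ) ^ k ≤ 2 * Real.exp (-((1 + ε) * (2 * Real.log n))) := by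
    have h5 : (1 + ε) * (2 * Real.log n) ≤ (k + 1) * Real.log 2 := by
      calc (1 + ε) * (2 * Real.log n)
          = (1 + ε) * (2 * Real.log n / Real.log 2) * Real.log 2 := by field_simp
        _ ≤ _ := by gcongr; exact (Nat.lt_floor_add_one _).le
    calc (1 / 2 : ℝ) ^ k = Real.exp (-(k * Real.log 2)) := by
          rw [Real.exp_neg, Real.exp_nat_mul, Real.exp_log (by norm_num), one_div, inv_pow]
      _ ≤ Real.exp (Real.log 2 + -((1 + ε) * (2 * Real.log n))) :=
        Real.exp_le_exp.mpr (by linarith)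
      _ = _ := by rw [Real.exp_add, Real.exp_log (by norm_num)]
  have h4 : (I.card : ℝ) * (1 / 2) ^ k ≤ 2 * Real.exp (-(2 * ε * Real.log n)) := by
    calc (I.card : ℝ) * (1 / 2) ^ k
        ≤ n ^ 2 * (2 * Real.exp (-((1 + ε) * (2 * Real.log n)))) := by gcongr
      _ = 2 * (Real.exp (Real.log n + Real.log n) *
          Real.exp (-((1 + ε) * (2 * Real.log n)))) := by
        rw [Real.exp_add, Real.exp_log hnpos]; ring
      _ = _ := by rw [← Real.exp_add]; congr 2; ring
  refine le_trans (graphFreq_mono fun G hG => ?_) (h3.trans h4)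
  by_contra! hcon
  refine hG (le_trans ?_ hk0)
  rw [← hW]
  refine Nat.cast_le.mpr (localizationNumber_le_card_of_adj mayStay fun a b hab ha hb => ?_)
  obtain ⟨w, hw, hw'⟩ := hcon (a, b) (by simp [I, hab, ha, hb])
  refine ⟨w, hw, fun h => ?_⟩
  simp only at hw'
  tauto

theorem almostAllGraphs_le_localizationNumber (mayStay : Bool) {ε : ℝ} (hε : 0 < ε) :
    AlmostAllGraphs fun n G =>
      (1 - ε) * (2 * Real.log n / Real.log 2) ≤ (localizationNumber G mayStay : ℝ) := by
  have hlog : Tendsto (fun n : ℕ => Real.log n) atTop atTop :=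
    Real.tendsto_log_atTop.comp tendsto_natCast_atTop_atTop
  have hl2 : 0 < Real.log 2 := Real.log_pos (by norm_num)
  rcases le_or_gt 1 ε with h1 | h1
  · refine almostAllGraphs_of_forall fun n G => ?_
    have hlogn : 0 ≤ Real.log n := Real.log_natCast_nonneg n
    exact (mul_nonpos_of_nonpos_of_nonneg (by linarith) (by positivity)).trans (Nat.cast_nonneg _)
  have hlin : ∀ᶠ n : ℕ in atTop, Real.log n ≤ 1 / 4 * n := by
    have := Real.isLittleO_log_id_atTop.def (show (0 : ℝ) < 1 / 4 by norm_num)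
    filter_upwards [tendsto_natCast_atTop_atTop.eventually this] with n hn
    simp only [Real.norm_eq_abs, id, Nat.abs_cast] at hn
    exact (le_abs_self _).trans hn
  refine (almostAllGraphs_exists_common_neighbor.and
    (almostAllGraphs_exists_same_neighbors hε h1)).mono ?_
  filter_upwards [hlin, eventually_ge_atTop 1] with n hlin hn G hG
  have hnpos : (0 : ℝ) < n := by exact_mod_cast hn
  have : Nonempty (Fin n) := ⟨⟨0, hn⟩⟩
  have hlogn : 0 ≤ Real.log n := Real.log_natCast_nonneg n
  refine (Nat.lt_floor_add_one _).le.trans ?_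
  refine mod_cast lt_localizationNumber ?_ hG.1 hG.2
  rw [Fintype.card_fin, Nat.floor_lt' (by omega)]
  have h2 : (1 - ε) * (2 * Real.log n / Real.log 2) ≤ 2 * Real.log n / Real.log 2 :=
    mul_le_of_le_one_left (by positivity) (by linarith)
  refine h2.trans_lt ?_
  rw [div_lt_iff₀ hl2]
  have := Real.log_two_gt_d9
  nlinarith

end AlmostAllProperties

theorem mainTheorem4 (mayStay : Bool) :
    (∀ ε : ℝ, 0 < ε → AlmostAllGraphs (fun n G =>
      (1 - ε) * (2 * Real.log n / Real.log 2) ≤ (localizationNumber G mayStay : ℝ) ∧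
      (localizationNumber G mayStay : ℝ) ≤ (1 + ε) * (2 * Real.log n / Real.log 2))) ∧
    ∀ n : ℕ, 2 * Real.log n / Real.log 2 = 2 * Real.logb 2 n :=
  ⟨fun _ hε => (almostAllGraphs_le_localizationNumber mayStay hε).and
    (almostAllGraphs_localizationNumber_le mayStay hε), fun _ => mul_div_assoc _ _ _⟩
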